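/- Let $\mathcal{O}$ be a finite set of operation symbols. A Boolean algebra with operators (BAO) of signature $\mathcal{O}$ is an algebra $\mathbf{A}=\langle A,\wedge,\vee,\neg,0,1,(f)_{f\in\mathcal{O}}\rangle$ such that $\langle A,\wedge,\vee,\neg,0,1\rangle$ is a Boolean algebra and each $f\in\mathcal{O}$ is a multiplicative operator, i.e. preserves all finite meets (including the empty meet $1$) in each coordinate. Put $$\Box x \;=\; x\wedge\bigwedge_{f\in\mathcal{O}}\ \bigwedge_{i}\bigl(f(0,\dots,0,x,0,\dots,0)\wedge x\bigr)\quad(x\text{ at coordinate } i),\qquad \Diamond x=\neg\Box\neg x .$$ Let $\mathcal{V}$ be a variety of BAOs of signature $\mathcal{O}$ such that: 1. $\mathcal{V}$ is *cyclic*: $\Box$ has a term-definable conjugate, i.e. there is a unary term $g$ such that in every member of $\mathcal{V}$, for all $x,y$, $\ \Diamond x\wedge y=0\iff x\wedge g(y)=0$. 2. $\mathcal{V}$ is *closed under canonical extensions*: for every $\mathbf{A}\in\mathcal{V}$ we have $\mathbf{A}^\sigma\in\mathcal{V}$. Here the universe of $\mathbf{A}^\sigma$ is the canonical extension of the poset of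 $\mathbf{A}$ (its dense and compact completion), and each operation symbol $o$ is interpreted by the extension $(o^{\mathbf A})^\sigma$ or $(o^{\mathbf A})^\pi$, the choice between the two being fixed for each symbol. For $f\colon A^n\to A$, and with $p,q$ ranging over the tuples of closed, respectively open, elements, $$f^\sigma(x)=\bigvee_{p\le x\le q}\ \bigwedge\{f(a)\mid a\in A^n,\ p\le a\le q\},\qquad f^\pi(x)=\bigwedge_{p\le x\le q}\ \bigvee\{f(a)\mid a\in A^n,\ p\le a\le q\}.$$ 3. $\mathcal{V}$ is *coherent*: every finitely generated subalgebra of a finitely presented member of $\mathcal{V}$ is finitely presented. Then $\mathcal{V}$ is a discriminator variety: there are a ternary term $t$ and a class $\mathcal{K}$ of algebras generating $\mathcal{V}$ as a variety such that in every member of $\mathcal{K}$, $t(x,y,z)=z$ if $x=y$ and $t(x,y,z)=x$ if $x\neq y$. -/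

import Mathlib

universe u v w

namespace BAOVariety

open FirstOrder FirstOrder.Language


/-! ### Equational classes, finite presentability, coherence, discriminator varieties

A variety is given by a set of identities `E` in countably many variables; its members are the
algebras that satisfy `E`. All languages used below have function symbols only. -/

section UniversalAlgebra

variable {L : FirstOrder.Language.{u, v}}

/-- `A` satisfies all identities in `E`, that is, `A` is a member of the variety defined by `E`. -/
def Satisfies (E : Set (L.Term ℕ × L.Term ℕ)) (A : Type w) [L.Structure A] : Prop :=
  ∀ p ∈ E, ∀ x : ℕ → A, p.1.realize x = p.2.realize x

/-- `A` is a finitely presented member of the variety defined by `E`: it belongs to the variety and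
it is the algebra presented there by finitely many generators `a` and finitely many relations `R`.
(The homomorphism in the last clause is unique, because `a` generates `A`.) -/
def FinitelyPresented (E : Set (L.Term ℕ × L.Term ℕ)) (A : Type u) [L.Structure A] : Prop :=
  Satisfies E A ∧
    ∃ (n : ℕ) (a : Fin n → A) (R : Set (L.Term (Fin n) × L.Term (Fin n))),
      R.Finite ∧
      Substructure.closure L (Set.range a) = ⊤ ∧
      (∀ r ∈ R, r.1.realize a = r.2.realize a) ∧
      ∀ (B : Type u) [L.Structure B], Satisfies E B →
        ∀ b : Fin n → B, (∀ r ∈ R, r.1.realize b = r.2.realize b) →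
          ∃ φ : A →[L] B, ∀ i, φ (a i) = b i

/-- A variety is coherent if every finitely generated subalgebra of a finitely presented member is
finitely presented. -/
def Coherent (E : Set (L.Term ℕ × L.Term ℕ)) : Prop :=
  ∀ (A : Type u) [L.Structure A], FinitelyPresented E A →
    ∀ S : L.Substructure A, S.FG → FinitelyPresented E S

/-- The ternary term `t` induces the discriminator function on `A`. -/
def IsDiscriminatorTerm (t : L.Term (Fin 3)) (A : Type w) [L.Structure A] : Prop :=
  ∀ x y z : A, (x = y → t.realize ![x, y, z] = z) ∧ (x ≠ y → t.realize ![x, y, z] = x)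

/-- The variety defined by `E` is a discriminator variety: it is the variety generated by some
class `K` of algebras that have a common discriminator term. (The last clause says that the
variety defined by `E` is the smallest variety containing `K`.) -/
def IsDiscriminatorVariety (E : Set (L.Term ℕ × L.Term ℕ)) : Prop :=
  ∃ (K : ∀ A : Type u, L.Structure A → Prop) (t : L.Term (Fin 3)),
    (∀ (A : Type u) [inst : L.Structure A], K A inst → IsDiscriminatorTerm t A) ∧
    (∀ (A : Type u) [inst : L.Structure A], K A inst → Satisfies E A) ∧
    ∀ E' : Set (L.Term ℕ × L.Term ℕ),
      (∀ (A : Type u) [inst : L.Structure A], K A inst → Satisfies E' A) →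
        ∀ (A : Type u) [L.Structure A], Satisfies E A → Satisfies E' A

end UniversalAlgebra

/-! ### Canonical extensions of posets and of operations -/

section CanonicalExtension

variable {P : Type u} [PartialOrder P] {C : Type v} [CompleteLattice C]

/-- The closed elements of a completion: meets of elements of the poset. -/
def closedElements (e : P ↪o C) : Set C := {c | ∃ X : Set P, c = sInf (e '' X)}

/-- The open elements of a completion: joins of elements of the poset. -/
def openElements (e : P ↪o C) : Set C := {c | ∃ X : Set P, c = sSup (e '' X)}

/-- The completion `e : P ↪o C` preserves existing finite meets and joins, is dense and is compact;
that is, it is a canonical extension of the poset `P`. -/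
structure IsCanonicalExtension (e : P ↪o C) : Prop where
  map_meet : ∀ s : Set P, s.Finite → ∀ a, IsGLB s a → IsGLB (e '' s) (e a)
  map_join : ∀ s : Set P, s.Finite → ∀ a, IsLUB s a → IsLUB (e '' s) (e a)
  join_closed : ∀ c : C, ∃ S ⊆ closedElements e, c = sSup S
  meet_open : ∀ c : C, ∃ S ⊆ openElements e, c = sInf S
  compact : ∀ S ⊆ closedElements e, ∀ T ⊆ openElements e,
    sInf S ≤ sSup T ↔
      ∃ S₀ ⊆ S, ∃ T₀ ⊆ T, S₀.Finite ∧ T₀.Finite ∧ sInf S₀ ≤ sSup T₀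

/-- The extension `f^σ` of an `n`-ary operation `f` on `P`; the closed and the open elements of
`C^n`, the canonical extension of `P^n`, are taken coordinatewise. -/
def sigmaExt (e : P ↪o C) {n : ℕ} (f : (Fin n → P) → P) (x : Fin n → C) : C :=
  sSup {c | ∃ p q : Fin n → C, (∀ i, p i ∈ closedElements e) ∧ (∀ i, q i ∈ openElements e) ∧
    p ≤ x ∧ x ≤ q ∧ c = sInf {d | ∃ a : Fin n → P, p ≤ e ∘ a ∧ e ∘ a ≤ q ∧ d = e (f a)}}

/-- The extension `f^π` of an `n`-ary operation `f` on `P`. -/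
def piExt (e : P ↪o C) {n : ℕ} (f : (Fin n → P) → P) (x : Fin n → C) : C :=
  sInf {c | ∃ p q : Fin n → C, (∀ i, p i ∈ closedElements e) ∧ (∀ i, q i ∈ openElements e) ∧
    p ≤ x ∧ x ≤ q ∧ c = sSup {d | ∃ a : Fin n → P, p ≤ e ∘ a ∧ e ∘ a ≤ q ∧ d = e (f a)}}

/-- The two ways of extending an operation to the canonical extension. -/
inductive ExtKind : Type
  | sigma
  | pi

/-- `f^σ` or `f^π`, according to the first argument. -/
def opExt : ExtKind → (P ↪o C) → {n : ℕ} → ((Fin n → P) → P) → (Fin n → C) → C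
  | ExtKind.sigma, e, _, f => sigmaExt e f
  | ExtKind.pi, e, _, f => piExt e f

/-- `e : P ↪o C` exhibits the algebra `C` as the canonical extension of the ordered algebra `P`:
`C` is the canonical extension of the poset `P`, and every operation symbol is interpreted in `C`
by the `σ`- or the `π`-extension of its interpretation in `P`, as prescribed by `ε`. -/
def IsCanonicalExtensionAlgebra {L : FirstOrder.Language.{u, 0}} (ε : ∀ n : ℕ, L.Functions n → ExtKind)
    [L.Structure P] [L.Structure C] (e : P ↪o C) : Prop :=
  IsCanonicalExtension e ∧
    ∀ (n : ℕ) (f : L.Functions n) (x : Fin n → C),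
      Structure.funMap f x =
        opExt (ε n f) e (fun a : Fin n → P => Structure.funMap f a) x

end CanonicalExtension

/-! ### Boolean algebras with operators -/

/-- The operation symbols of Boolean algebras with operators: the Boolean operations, and the
operators; `O n` is the set of `n`-ary operators. -/
inductive BAOFunctions (O : ℕ → Type u) : ℕ → Type u
  | inf : BAOFunctions O 2
  | sup : BAOFunctions O 2
  | compl : BAOFunctions O 1
  | bot : BAOFunctions O 0
  | top : BAOFunctions O 0
  | op {n : ℕ} (f : O n) : BAOFunctions O n

/-- The language of Boolean algebras with operators of signature `O`. -/
def baoLanguage (O : ℕ → Type u) : FirstOrder.Language.{u, 0} where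
  Functions := BAOFunctions O
  Relations := fun _ => Empty

section BAO

variable (O : ℕ → Type u)

/-- The operation of an algebra `A` that interprets the operator symbol `f`. -/
def oper {O : ℕ → Type u} {A : Type w} [(baoLanguage O).Structure A] {n : ℕ} (f : O n) :
    (Fin n → A) → A :=
  Structure.funMap (L := baoLanguage O) (BAOFunctions.op f)

/-- The Boolean symbols are interpreted by the operations of the Boolean algebra `A`, and each
operator preserves all finite meets (also the empty one) in each coordinate. -/
structure IsBAO (A : Type w) [BooleanAlgebra A] [(baoLanguage O).Structure A] : Prop where
  map_inf : ∀ x : Fin 2 → A,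
    Structure.funMap (L := baoLanguage O) BAOFunctions.inf x = x 0 ⊓ x 1
  map_sup : ∀ x : Fin 2 → A,
    Structure.funMap (L := baoLanguage O) BAOFunctions.sup x = x 0 ⊔ x 1
  map_compl : ∀ x : Fin 1 → A,
    Structure.funMap (L := baoLanguage O) BAOFunctions.compl x = (x 0)ᶜ
  map_bot : ∀ x : Fin 0 → A,
    Structure.funMap (L := baoLanguage O) BAOFunctions.bot x = ⊥
  map_top : ∀ x : Fin 0 → A,
    Structure.funMap (L := baoLanguage O) BAOFunctions.top x = ⊤
  oper_meet : ∀ (n : ℕ) (f : O n) (x : Fin n → A) (i : Fin n) (s : Finset A),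
    oper f (Function.update x i (s.inf id)) = s.inf fun a => oper f (Function.update x i a)

variable {O}

/-- The identities `E` define a variety of Boolean algebras with operators. -/
def IsVarietyOfBAOs (E : Set ((baoLanguage O).Term ℕ × (baoLanguage O).Term ℕ)) : Prop :=
  ∀ (A : Type u) [(baoLanguage O).Structure A], Satisfies E A →
    ∃ _ : BooleanAlgebra A, IsBAO O A

/-- The variety of Boolean algebras with operators defined by `E` is closed under canonical
extensions, where the operations are extended as prescribed by `ε`. -/
def ClosedUnderCanonicalExtensions
    (ε : ∀ n : ℕ, (baoLanguage O).Functions n → ExtKind)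
    (E : Set ((baoLanguage O).Term ℕ × (baoLanguage O).Term ℕ)) : Prop :=
  ∀ (A : Type u) [BooleanAlgebra A] [(baoLanguage O).Structure A], IsBAO O A → Satisfies E A →
    ∀ (C : Type u) [CompleteLattice C] [(baoLanguage O).Structure C] (e : A ↪o C),
      IsCanonicalExtensionAlgebra ε e → Satisfies E C

/-- `f(0, …, 0, x, 0, …, 0) ∧ x`, with `x` at coordinate `i`. -/
def boxAt {A : Type w} [BooleanAlgebra A] [(baoLanguage O).Structure A] {n : ℕ} (f : O n)
    (i : Fin n) (x : A) : A :=
  oper f (Function.update (fun _ => ⊥) i x) ⊓ x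

/-- For a finite signature, `□ x` is the meet of `x` and of all `f(0, …, 0, x, 0, …, 0) ∧ x`, over
all operators `f` and all coordinates of `f`. (The first `x` only matters when there is no operator
of positive arity.) -/
def box [Fintype (Σ n, O n)] {A : Type w} [BooleanAlgebra A] [(baoLanguage O).Structure A]
    (x : A) : A :=
  x ⊓ Finset.univ.inf fun f : Σ n, O n => Finset.univ.inf fun i : Fin f.1 => boxAt f.2 i x

/-- A variety of Boolean algebras with operators of finite signature is cyclic if the operator
`□`, that is, its additive form `◇ x = ¬ □ ¬ x`, has a term-definable conjugate `g`:
`◇ x ∧ y = 0` if and only if `x ∧ g(y) = 0`. (It follows that `g` preserves finite joins.) -/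
def IsCyclic [Fintype (Σ n, O n)]
    (E : Set ((baoLanguage O).Term ℕ × (baoLanguage O).Term ℕ)) : Prop :=
  ∃ g : (baoLanguage O).Term (Fin 1),
    ∀ (A : Type u) [BooleanAlgebra A] [(baoLanguage O).Structure A], IsBAO O A → Satisfies E A →
      ∀ x y : A, (box (O := O) xᶜ)ᶜ ⊓ y = ⊥ ↔ x ⊓ g.realize ![y] = ⊥

end BAO

end BAOVariety

namespace BAOVariety

open FirstOrder FirstOrder.Language

/-! ### Finite presentations and coherence. -/

section Presentations

variable {L : FirstOrder.Language.{u, v}}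

/-! The proof has two halves: some power of `□` is idempotent throughout the variety, and cyclicity
then makes it a discriminator.

Stabilization (`exists_box_iterate_le_succ`). Suppose `□ᴺ x_N ≰ □ᴺ⁺¹ x_N` in a member `A_N`, for
every `N`. Present `F` by generators `x, y, z` and the relations `z ≤ y ≤ x`, `y ≤ □y`. Then `z ≤ □ᵏ
x` in `F` for all `k`. By coherence, finitely many relations `Q` between `x` and `z` alone imply all
of these. In an ultraproduct `B` of the `A_N`, the classes of `x_N` and `□ᴺ x_N` satisfy `z ≤ □ᵏ x`
for all `k`. In the canonical extension of `B`, the closed element `m = ⋀ □ᵏ x` can play the part of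
`y`, so `F` maps there. Hence `Q` holds in the extension, so in `B`, so in some `A_N`. There it
yields `□ᴺ x_N ≤ □ᴺ⁺¹ x_N`, a contradiction.

Discriminator. For a `□`-fixed `a`, the relation `a ∧ x = a ∧ y` is a congruence
(`IsBAO.inf_funMap_congr`). Applying this to the conjugate `g` shows that `¬a` is `□`-fixed too
(`BoxClosed.compl_of_conjugate`). Dividing by the `□`-fixed elements of an ultrafilter leaves only
`0` and `1` fixed, and such quotients separate points (`exists_hom_simple`). On them `□ᴺ(x ↔ y)` is
`1` if `x = y` and `0` otherwise, which gives the discriminator term. -/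

theorem exists_term_of_mem_closure_range {A : Type w} [L.Structure A] {ι : Type*} (c : ι → A) {x : A}
    (hx : x ∈ Substructure.closure L (Set.range c)) : ∃ t : L.Term ι, t.realize c = x := by
  obtain ⟨t, rfl⟩ := Substructure.mem_closure_iff_exists_term.1 hx
  choose g hg using fun y : Set.range c => y.2
  refine ⟨t.relabel g, ?_⟩
  rw [Term.realize_relabel]
  congr 1
  funext y
  exact hg y

/-- The absolutely free algebra over `α`. -/
@[reducible]
def termStructure (L : FirstOrder.Language.{u, v}) (α : Type w) : L.Structure (L.Term α) where
  funMap f ts := Term.func f ts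
  -- Empty relations make homomorphisms out of quotients of this algebra preserve them vacuously.
  RelMap _ _ := False

theorem realize_termStructure {α : Type w} {β : Type*} (x : β → L.Term α) (t : L.Term β) :
    @Term.realize L _ (termStructure L α) β x t = t.subst x := by
  induction t with
  | var => rfl
  | func f ts ih =>
    simp only [Term.realize, Term.subst, ih]
    rfl

/-- The algebra presented by finitely many relations in the variety defined by `E`. -/
theorem exists_finitelyPresented (E : Set (L.Term ℕ × L.Term ℕ)) {n : ℕ}
    (R : Set (L.Term (Fin n) × L.Term (Fin n))) (hR : R.Finite) :
    ∃ (F : Type u) (_ : L.Structure F) (a : Fin n → F), FinitelyPresented E F ∧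
      (∀ r ∈ R, r.1.realize a = r.2.realize a) ∧
      ∀ (B : Type u) [L.Structure B], Satisfies E B →
        ∀ b : Fin n → B, (∀ r ∈ R, r.1.realize b = r.2.realize b) →
          ∃ φ : F →[L] B, ∀ i, φ (a i) = b i := by
  -- Semantic consequence of `R` serves as the congruence, so the universal property is built in.
  let s : Setoid (L.Term (Fin n)) :=
    { r := fun s t => ∀ (B : Type u) [L.Structure B], Satisfies E B →
        ∀ b : Fin n → B, (∀ r ∈ R, r.1.realize b = r.2.realize b) → s.realize b = t.realize b
      iseqv := ⟨fun _ _ _ _ _ _ => rfl, fun h B _ hB b hb => (h B hB b hb).symm,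
        fun h h' B _ hB b hb => (h B hB b hb).trans (h' B hB b hb)⟩ }
  let ps : L.Prestructure s :=
    { toStructure := termStructure L (Fin n)
      fun_equiv := fun {m f} x y hxy B _ hB b hb => by
        change Structure.funMap f _ = Structure.funMap f _
        congr 1
        funext i
        exact hxy i B hB b hb
      rel_equiv := fun _ _ _ => rfl }
  let a : Fin n → Quotient s := fun i => ⟦Term.var i⟧
  have real : ∀ {β : Type} (x : β → L.Term (Fin n)) (t : L.Term β),
      t.realize (fun i => (⟦x i⟧ : Quotient s)) = ⟦t.subst x⟧ := fun x t => by
    rw [Term.realize_quotient_mk' s t x]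
    exact congrArg _ (realize_termStructure x t)
  have reala : ∀ t : L.Term (Fin n), t.realize a = ⟦t⟧ := fun t => by
    rw [real]
    congr 1
    induction t with
    | var => rfl
    | func f ts ih => simp only [Term.subst, ih]
  have hsat : Satisfies E (Quotient s) := by
    intro p hp x
    choose y hy using fun i => Quotient.exists_rep (x i)
    obtain rfl : (fun i => ⟦y i⟧) = x := funext hy
    rw [real, real]
    refine Quotient.sound fun B _ hB b hb => ?_
    rw [Term.realize_subst, Term.realize_subst]
    exact hB p hp _
  have hrel : ∀ r ∈ R, r.1.realize a = r.2.realize a := fun r hr => by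
    rw [reala, reala]
    exact Quotient.sound fun B _ hB b hb => hb r hr
  have huniv : ∀ (B : Type u) [L.Structure B], Satisfies E B →
        ∀ b : Fin n → B, (∀ r ∈ R, r.1.realize b = r.2.realize b) →
          ∃ φ : Quotient s →[L] B, ∀ i, φ (a i) = b i := by
    intro B _ hB b hb
    refine ⟨⟨Quotient.lift (fun t => t.realize b) fun s t h => h B hB b hb, ?_, ?_⟩, fun i => rfl⟩
    · intro m f x
      choose y hy using fun i => Quotient.exists_rep (x i)
      obtain rfl : (fun i => ⟦y i⟧) = x := funext hy
      rw [funMap_quotient_mk']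
      rfl
    · intro m r x
      choose y hy using fun i => Quotient.exists_rep (x i)
      obtain rfl : (fun i => ⟦y i⟧) = x := funext hy
      rw [relMap_quotient_mk']
      exact False.elim
  refine ⟨Quotient s, inferInstance, a, ⟨hsat, n, a, R, hR, ?_, hrel, huniv⟩, hrel, huniv⟩
  refine eq_top_iff.2 fun x _ => ?_
  obtain ⟨t, rfl⟩ := Quotient.exists_rep x
  rw [← reala]
  exact t.realize_mem _ fun i => Substructure.subset_closure ⟨i, rfl⟩

/-- In a coherent variety, the relations between finitely many elements of a finitely presented
algebra follow from finitely many of them. -/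
theorem Coherent.exists_finite_relations {E : Set (L.Term ℕ × L.Term ℕ)} (hE : Coherent E)
    {F : Type u} [L.Structure F] (hF : FinitelyPresented E F) {k : ℕ} (c : Fin k → F) :
    ∃ R : Set (L.Term (Fin k) × L.Term (Fin k)), R.Finite ∧
      (∀ r ∈ R, r.1.realize c = r.2.realize c) ∧
      ∀ (B : Type u) [L.Structure B], Satisfies E B →
        ∀ b : Fin k → B, (∀ r ∈ R, r.1.realize b = r.2.realize b) →
          ∀ s t : L.Term (Fin k), s.realize c = t.realize c → s.realize b = t.realize b := by
  let S := Substructure.closure L (Set.range c)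
  obtain ⟨-, n, a, R, hRfin, hgen, hR, huniv⟩ :=
    hE F hF S (Substructure.fg_closure (Set.finite_range c))
  let c' : Fin k → S := fun j => ⟨c j, Substructure.subset_closure ⟨j, rfl⟩⟩
  choose τ hτ using fun i => exists_term_of_mem_closure_range c (a i).2
  choose ξ hξ using fun j => exists_term_of_mem_closure_range a
    (show c' j ∈ Substructure.closure L (Set.range a) by rw [hgen]; trivial)
  have hc' : (fun j => S.subtype (c' j)) = c := rfl
  have hτ' : ∀ i, (τ i).realize c' = a i := fun i => by
    apply S.subtype_injective
    rw [← HomClass.realize_term]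
    exact hτ i
  have key : ∀ s : L.Term (Fin k), s.realize c = S.subtype (s.realize c') := fun s => by
    rw [← HomClass.realize_term]
    rfl
  have keya : ∀ s : L.Term (Fin n), (s.subst τ).realize c = S.subtype (s.realize a) := fun s => by
    rw [key, Term.realize_subst]
    simp only [hτ']
  -- A change of generators: the old relations are rewritten through `a i = τ i (c)`, and `ξ j (τ
  -- (c)) = c j` is added so that the old generators give back the new ones.
  refine ⟨(fun r => (r.1.subst τ, r.2.subst τ)) '' R ∪
    Set.range fun j => ((ξ j).subst τ, Term.var j), (hRfin.image _).union (Set.finite_range _),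
    ?_, ?_⟩
  · rintro _ (⟨r, hr, rfl⟩ | ⟨j, rfl⟩)
    · rw [keya, keya, hR r hr]
    · rw [keya, hξ]
      rfl
  · intro B _ hB b hb s t hst
    obtain ⟨ψ, hψ⟩ := huniv B hB (fun i => (τ i).realize b) fun r hr => by
      have := hb _ (Or.inl ⟨r, hr, rfl⟩)
      simpa only [Term.realize_subst] using this
    have hψc : ∀ j, ψ (c' j) = b j := fun j => by
      have := hb _ (Or.inr ⟨j, rfl⟩)
      rw [Term.realize_subst] at this
      rw [← hξ j, ← HomClass.realize_term]
      simpa only [Function.comp_def, hψ, Term.realize_var] using this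
    have hb' : b = ψ ∘ c' := funext fun j => (hψc j).symm
    rw [key, key] at hst
    rw [hb', HomClass.realize_term, HomClass.realize_term, S.subtype_injective hst]

end Presentations

/-! ### Ultraproducts and identities. -/

section Ultraproduct

variable {L : FirstOrder.Language.{u, v}}

theorem Satisfies.ultraproduct {E : Set (L.Term ℕ × L.Term ℕ)} {ι : Type*} {M : ι → Type w}
    [∀ i, L.Structure (M i)] (U : Ultrafilter ι) (h : ∀ i, Satisfies E (M i)) :
    Satisfies E ((U : Filter ι).Product M) := by
  intro p hp x
  have hx : ∀ i, ∃ y : ∀ a, M a, (y : (U : Filter ι).Product M) = x i :=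
    fun i => Quotient.exists_rep (x i)
  choose y hy using hx
  have key : ∀ t : L.Term ℕ, t.realize x =
      ((fun a => t.realize fun i => y i a : ∀ a, M a) : (U : Filter ι).Product M) := fun t =>
    (congrArg (fun z => t.realize z) (funext hy).symm).trans (Ultraproduct.term_realize_cast y t)
  rw [key, key]
  congr 1
  funext a
  exact h a p hp _

theorem ultraproduct_realize_eq_iff {ι : Type*} {M : ι → Type w} [∀ i, L.Structure (M i)]
    (U : Ultrafilter ι) {β : Type*} (x : β → ∀ i, M i) (s t : L.Term β) :
    (s.realize (fun b => (x b : (U : Filter ι).Product M)) =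
      t.realize fun b => (x b : (U : Filter ι).Product M)) ↔
      ∀ᶠ i in (U : Filter ι), s.realize (fun b => x b i) = t.realize fun b => x b i := by
  rw [Ultraproduct.term_realize_cast, Ultraproduct.term_realize_cast]
  exact Quotient.eq''

end Ultraproduct

/-! ### Stone duality and a concrete canonical extension. -/

section Stone

/-- The ultrafilters of a Boolean algebra, as characteristic functions. -/
def StoneSpace (B : Type u) [BooleanAlgebra B] : Type u :=
  {h : B → Bool // h ⊤ = true ∧ (∀ a b, h (a ⊓ b) = (h a && h b)) ∧ ∀ a, h aᶜ = !h a}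

variable {B : Type u} [BooleanAlgebra B]

instance : TopologicalSpace (StoneSpace B) :=
  inferInstanceAs (TopologicalSpace (Subtype _))

instance : CompactSpace (StoneSpace B) := by
  refine isCompact_iff_compactSpace.1 (IsClosed.isCompact (X := B → Bool) ?_)
  refine (isClosed_eq (continuous_apply _) continuous_const).inter (IsClosed.inter ?_ ?_)
  · change IsClosed {h : B → Bool | ∀ a b, h (a ⊓ b) = (h a && h b)}
    simp only [Set.ofPred_forall]
    refine isClosed_iInter fun a => isClosed_iInter fun b => isClosed_eq (continuous_apply _) ?_
    have hab : Continuous fun h : B → Bool => (h a, h b) :=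
      (continuous_apply a).prodMk (continuous_apply b)
    exact (continuous_of_discreteTopology (f := fun p : Bool × Bool => p.1 && p.2)).comp hab
  · change IsClosed {h : B → Bool | ∀ a, h aᶜ = !h a}
    simp only [Set.ofPred_forall]
    exact isClosed_iInter fun a => isClosed_eq (continuous_apply _)
      ((continuous_of_discreteTopology (f := not)).comp (continuous_apply a))

/-- A prime ideal disjoint from the principal filter of `a` exists; its complement is the required
ultrafilter. -/
theorem exists_stoneSpace_apply_eq_true {a : B} (ha : a ≠ ⊥) :
    ∃ ω : StoneSpace B, ω.1 a = true := by
  classical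
  obtain ⟨J, hJ, -, hdis⟩ := DistribLattice.prime_ideal_of_disjoint_filter_ideal
    (F := Order.PFilter.principal a) (I := (⊥ : Order.Ideal B)) (by
      rw [Set.disjoint_left]
      intro b hb hb'
      have h1 : a ≤ b := hb
      have h2 : b = ⊥ := le_bot_iff.1 hb'
      exact ha (le_bot_iff.1 (h2 ▸ h1)))
  have hbot : (⊤ : B) ∉ J := hJ.toIsProper.top_notMem
  have hcompl : ∀ b, bᶜ ∈ J ↔ b ∉ J := fun b => by
    constructor
    · intro h h'
      apply hbot
      rw [← sup_compl_eq_top (x := b)]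
      exact Order.Ideal.sup_mem h' h
    · exact hJ.compl_mem_of_notMem
  refine ⟨⟨fun b => decide (b ∉ J), by simpa using hbot, fun b c => ?_, fun b => ?_⟩, ?_⟩
  · rw [← Bool.decide_and, decide_eq_decide, ← not_or, not_iff_not]
    exact ⟨hJ.mem_or_mem, fun h => h.elim (fun h => J.lower inf_le_left h)
      fun h => J.lower inf_le_right h⟩
  · rw [← decide_not, decide_eq_decide, hcompl]
  · exact decide_eq_true (Set.disjoint_left.1 hdis (show a ∈ Order.PFilter.principal a from le_rfl))

/-- The Stone embedding of a Boolean algebra into the powerset of its Stone space. -/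
def stoneEmb (B : Type u) [BooleanAlgebra B] : B ↪o Set (StoneSpace B) :=
  OrderEmbedding.ofMapLEIff (fun a => {ω | ω.1 a = true}) (fun a b => by
    constructor
    · intro h
      by_contra hab
      obtain ⟨ω, hω⟩ := exists_stoneSpace_apply_eq_true (a := a ⊓ bᶜ)
        fun h => hab (by rwa [← disjoint_iff, disjoint_compl_right_iff] at h)
      rw [ω.2.2.1, ω.2.2.2, Bool.and_eq_true, Bool.not_eq_true'] at hω
      have : ω.1 b = true := h hω.1
      simp [this] at hω
    · intro h ω hω
      have h1 := ω.2.2.1 a b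
      rw [inf_eq_left.2 h, show ω.1 a = true from hω] at h1
      exact (by simpa using h1 : ω.1 b = true))

theorem mem_stoneEmb {a : B} {ω : StoneSpace B} : ω ∈ stoneEmb B a ↔ ω.1 a = true := Iff.rfl

theorem stoneEmb_inf (a b : B) : stoneEmb B (a ⊓ b) = stoneEmb B a ⊓ stoneEmb B b := by
  ext ω
  rw [mem_stoneEmb, ω.2.2.1, Bool.and_eq_true]
  rfl

theorem stoneEmb_compl (a : B) : stoneEmb B aᶜ = (stoneEmb B a)ᶜ := by
  ext ω
  rw [mem_stoneEmb, ω.2.2.2, Set.mem_compl_iff, mem_stoneEmb]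
  simp

theorem stoneEmb_sup (a b : B) : stoneEmb B (a ⊔ b) = stoneEmb B a ⊔ stoneEmb B b := by
  rw [← compl_inj_iff, ← stoneEmb_compl, compl_sup, stoneEmb_inf, compl_sup, stoneEmb_compl,
    stoneEmb_compl]

theorem stoneEmb_top : stoneEmb B ⊤ = ⊤ := by
  ext ω
  simp [mem_stoneEmb, ω.2.1]

theorem stoneEmb_bot : stoneEmb B ⊥ = ⊥ := by
  rw [← compl_top, stoneEmb_compl, stoneEmb_top, compl_top]

theorem stoneEmb_finset_sup {ι : Type*} (s : Finset ι) (f : ι → B) :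
    stoneEmb B (s.sup f) = s.sup fun i => stoneEmb B (f i) :=
  Finset.apply_sup_eq_sup_comp (stoneEmb B) stoneEmb_sup stoneEmb_bot

theorem stoneEmb_finset_inf {ι : Type*} (s : Finset ι) (f : ι → B) :
    stoneEmb B (s.inf f) = s.inf fun i => stoneEmb B (f i) :=
  Finset.apply_inf_eq_inf_comp (stoneEmb B) stoneEmb_inf stoneEmb_top

theorem continuous_stoneSpace_apply (a : B) : Continuous fun ω : StoneSpace B => ω.1 a :=
  (continuous_apply a).comp continuous_subtype_val

theorem isClopen_stoneEmb (a : B) : IsClopen (stoneEmb B a) :=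
  (isClopen_discrete {true}).preimage (continuous_stoneSpace_apply a)

theorem isClosed_of_mem_closedElements {p : Set (StoneSpace B)}
    (hp : p ∈ closedElements (stoneEmb B)) : IsClosed p := by
  obtain ⟨X, rfl⟩ := hp
  refine isClosed_sInter ?_
  rintro _ ⟨a, -, rfl⟩
  exact (isClopen_stoneEmb a).1

theorem isOpen_of_mem_openElements {q : Set (StoneSpace B)}
    (hq : q ∈ openElements (stoneEmb B)) : IsOpen q := by
  obtain ⟨X, rfl⟩ := hq
  refine isOpen_sUnion ?_
  rintro _ ⟨a, -, rfl⟩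
  exact (isClopen_stoneEmb a).2

/-- A point is the meet of all clopen sets containing it; two ultrafilters, one contained in the
other, coincide. -/
theorem singleton_mem_closedElements (ω : StoneSpace B) :
    {ω} ∈ closedElements (stoneEmb B) := by
  refine ⟨{a | ω.1 a = true}, Set.Subset.antisymm ?_ ?_⟩
  · rintro _ rfl
    rintro _ ⟨a, ha, rfl⟩
    exact ha
  · intro η hη
    refine Subtype.ext (funext fun a => ?_)
    cases h : ω.1 a with
    | true => exact hη _ ⟨a, h, rfl⟩
    | false =>
      have h2 : ω.1 aᶜ = true := by rw [ω.2.2.2, h]; rfl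
      have h3 : η.1 aᶜ = true := hη _ ⟨aᶜ, h2, rfl⟩
      rw [η.2.2.2] at h3
      simpa using h3

theorem compl_singleton_mem_openElements (ω : StoneSpace B) :
    {ω}ᶜ ∈ openElements (stoneEmb B) := by
  obtain ⟨X, hX⟩ := singleton_mem_closedElements ω
  refine ⟨compl '' X, ?_⟩
  rw [hX, compl_sInf, ← sSup_image, Set.image_image, Set.image_image]
  simp only [stoneEmb_compl]

theorem emb_mem_closedElements {P : Type u} [PartialOrder P] {C : Type v} [CompleteLattice C]
    (e : P ↪o C) (a : P) : e a ∈ closedElements e :=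
  ⟨{a}, by rw [Set.image_singleton, sInf_singleton]⟩

theorem emb_mem_openElements {P : Type u} [PartialOrder P] {C : Type v} [CompleteLattice C]
    (e : P ↪o C) (a : P) : e a ∈ openElements e :=
  ⟨{a}, by rw [Set.image_singleton, sSup_singleton]⟩

theorem bot_mem_closedElements : (⊥ : Set (StoneSpace B)) ∈ closedElements (stoneEmb B) :=
  stoneEmb_bot (B := B) ▸ emb_mem_closedElements _ _

theorem top_mem_openElements : (⊤ : Set (StoneSpace B)) ∈ openElements (stoneEmb B) :=
  stoneEmb_top (B := B) ▸ emb_mem_openElements _ _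

/-- Between a closed element and an open element above it there is an element of the algebra. -/
theorem exists_stoneEmb_between {p q : Set (StoneSpace B)} (hp : p ∈ closedElements (stoneEmb B))
    (hq : q ∈ openElements (stoneEmb B)) (h : p ≤ q) :
    ∃ a : B, p ≤ stoneEmb B a ∧ stoneEmb B a ≤ q := by
  obtain ⟨Y, rfl⟩ := hq
  obtain ⟨t, ht⟩ := (isClosed_of_mem_closedElements hp).isCompact.elim_finite_subcover
    (fun y : Y => stoneEmb B y) (fun y => (isClopen_stoneEmb _).2) (by
      refine h.trans ?_
      rw [sSup_image']
      exact le_rfl)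
  refine ⟨t.sup fun y => (y : B), ?_, ?_⟩
  · rw [stoneEmb_finset_sup, Finset.sup_eq_iSup]
    exact ht
  · rw [stoneEmb_finset_sup]
    exact Finset.sup_le fun y _ => le_sSup ⟨y, y.2, rfl⟩

/-- The powerset of the Stone space is a canonical extension. -/
theorem isCanonicalExtension_stoneEmb : IsCanonicalExtension (stoneEmb B) where
  map_meet s hs a ha := by
    lift s to Finset B using hs
    obtain rfl : a = s.inf id := ha.unique (Finset.isGLB_inf_id (s := s))
    rw [stoneEmb_finset_inf]
    have := Finset.isGLB_inf_id (s := s.image (stoneEmb B))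
    rwa [Finset.inf_image, Finset.coe_image] at this
  map_join s hs a ha := by
    lift s to Finset B using hs
    obtain rfl : a = s.sup id := ha.unique (Finset.isLUB_sup_id (s := s))
    rw [stoneEmb_finset_sup]
    have := Finset.isLUB_sup_id (s := s.image (stoneEmb B))
    rwa [Finset.sup_image, Finset.coe_image] at this
  join_closed c := by
    refine ⟨(fun ω => {ω}) '' c, ?_, ?_⟩
    · rintro _ ⟨ω, -, rfl⟩
      exact singleton_mem_closedElements ω
    · ext ω
      simp
  meet_open c := by
    refine ⟨(fun ω => {ω}ᶜ) '' cᶜ, ?_, ?_⟩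
    · rintro _ ⟨ω, -, rfl⟩
      exact compl_singleton_mem_openElements ω
    · ext ω
      simp only [Set.sInf_eq_sInter, Set.mem_sInter, Set.forall_mem_image, Set.mem_compl_iff,
        Set.mem_singleton_iff]
      exact ⟨fun h η hη hωη => hη (hωη ▸ h), fun h => by_contra fun h' => h h' rfl⟩
  compact S hS T hT := by
    constructor
    · intro h
      obtain ⟨t, ht⟩ := (isClosed_sInter fun p hp =>
        isClosed_of_mem_closedElements (hS hp)).isCompact.elim_finite_subcover
        (fun q : T => (q : Set (StoneSpace B))) (fun q => isOpen_of_mem_openElements (hT q.2)) (by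
          rw [← Set.sUnion_eq_iUnion]
          exact h)
      have hopen : IsOpen (⋃ q ∈ t, (q : Set (StoneSpace B))) :=
        isOpen_biUnion fun q _ => isOpen_of_mem_openElements (hT q.2)
      -- Compactness is used a second time, on the complement of the finite union, to thin out the
      -- closed sets.
      obtain ⟨s, hs⟩ := hopen.isClosed_compl.isCompact.elim_finite_subfamily_closed
        (fun p : S => (p : Set (StoneSpace B))) (fun p => isClosed_of_mem_closedElements (hS p.2))
        (by
          rw [← Set.sInter_eq_iInter, ← Set.disjoint_iff_inter_eq_empty,
            Set.disjoint_compl_left_iff_subset]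
          exact ht)
      rw [← Set.disjoint_iff_inter_eq_empty, Set.disjoint_compl_left_iff_subset] at hs
      refine ⟨Subtype.val '' (s : Set S), by simp, Subtype.val '' (t : Set T), by simp,
        s.finite_toSet.image _, t.finite_toSet.image _, ?_⟩
      intro ω hω
      have := hs (Set.mem_iInter₂.2 fun p hp => hω p.1 ⟨p, hp, rfl⟩)
      obtain ⟨q, hq, hωq⟩ := Set.mem_iUnion₂.1 this
      exact ⟨q, ⟨q, hq, rfl⟩, hωq⟩
    · rintro ⟨S₀, hS₀, T₀, hT₀, -, -, h⟩
      exact (sInf_le_sInf hS₀).trans (h.trans (sSup_le_sSup hT₀))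

end Stone

/-! ### The `σ`- and `π`-extensions on the powerset of the Stone space. -/

section Extensions

/-- The interval from `e ∘ a` to itself contains only `a`, and every other admissible interval
around `e ∘ a` also contains `a`. Hence a canonical embedding is a homomorphism. -/
theorem opExt_emb {P : Type u} [PartialOrder P] {C : Type v} [CompleteLattice C] (k : ExtKind)
    (e : P ↪o C) {n : ℕ} (f : (Fin n → P) → P) (a : Fin n → P) :
    opExt k e f (e ∘ a) = e (f a) := by
  have huniq : ∀ b : Fin n → P, e ∘ a ≤ e ∘ b → e ∘ b ≤ e ∘ a → b = a := fun b h h' =>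
    e.injective.comp_left (le_antisymm h' h)
  cases k with
  | sigma =>
    refine le_antisymm (sSup_le ?_) (le_sSup ?_)
    · rintro _ ⟨p, q, -, -, hp, hq, rfl⟩
      exact sInf_le ⟨a, hp, hq, rfl⟩
    · refine ⟨e ∘ a, e ∘ a, fun i => emb_mem_closedElements e _, fun i => emb_mem_openElements e _,
        le_rfl, le_rfl, le_antisymm (le_sInf ?_) (sInf_le ⟨a, le_rfl, le_rfl, rfl⟩)⟩
      rintro _ ⟨b, hb, hb', rfl⟩
      rw [huniq b hb hb']
  | pi =>
    refine le_antisymm (sInf_le ?_) (le_sInf ?_)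
    · refine ⟨e ∘ a, e ∘ a, fun i => emb_mem_closedElements e _, fun i => emb_mem_openElements e _,
        le_rfl, le_rfl, le_antisymm (le_sSup ⟨a, le_rfl, le_rfl, rfl⟩) (sSup_le ?_)⟩
      rintro _ ⟨b, hb, hb', rfl⟩
      rw [huniq b hb hb']
    · rintro _ ⟨p, q, -, -, hp, hq, rfl⟩
      exact le_sSup ⟨a, hp, hq, rfl⟩

variable {B : Type u} [BooleanAlgebra B]

/-- A lower bound for the values of an operation above a tuple of closed elements is a lower bound
for the value of both extensions. -/
theorem le_opExt_of_closed (k : ExtKind) {n : ℕ} (f : (Fin n → B) → B)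
    {p : Fin n → Set (StoneSpace B)} (hp : ∀ i, p i ∈ closedElements (stoneEmb B))
    {m : Set (StoneSpace B)} (hm : ∀ a : Fin n → B, p ≤ stoneEmb B ∘ a → m ≤ stoneEmb B (f a)) :
    m ≤ opExt k (stoneEmb B) f p := by
  cases k with
  | sigma =>
    refine le_trans (le_sInf ?_) (le_sSup ⟨p, ⊤, hp, fun i => top_mem_openElements, le_rfl, le_top,
      rfl⟩)
    rintro _ ⟨a, ha, -, rfl⟩
    exact hm a ha
  | pi =>
    refine le_sInf ?_
    rintro _ ⟨p', q, -, hq, hp', hpq, rfl⟩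
    -- Any open tuple above `p` leaves room for a tuple of the algebra above `p`, so each join in
    -- the `π`-extension has a term to which `hm` applies.
    choose a ha using fun i => exists_stoneEmb_between (hp i) (hq i) (hpq i)
    exact (hm a fun i => (ha i).1).trans
      (le_sSup ⟨a, hp'.trans fun i => (ha i).1, fun i => (ha i).2, rfl⟩)

/-- The identities are known to hold only for the extended operations. The extended meet must
therefore be the true intersection before inequalities can be read off from terms. -/
theorem opExt_inf (k : ExtKind) (x : Fin 2 → Set (StoneSpace B)) :
    opExt k (stoneEmb B) (fun a : Fin 2 → B => a 0 ⊓ a 1) x = x 0 ⊓ x 1 := by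
  cases k with
  | sigma =>
    refine le_antisymm (sSup_le ?_) ?_
    · rintro _ ⟨p, q, hp, hq, hpx, hxq, rfl⟩
      choose a ha using fun i => exists_stoneEmb_between (hp i) (hq i) (hpx.trans hxq i)
      -- Meeting the `i`-th coordinate with any `b` above `p i` stays inside the interval, so the
      -- infimum lies below every such `b`.
      have key : ∀ i, sInf {d | ∃ a : Fin 2 → B, p ≤ stoneEmb B ∘ a ∧ stoneEmb B ∘ a ≤ q ∧
          d = stoneEmb B (a 0 ⊓ a 1)} ≤ p i := by
        intro i
        obtain ⟨X, hX⟩ := hp i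
        rw [hX]
        refine le_sInf ?_
        rintro _ ⟨b, hb, rfl⟩
        refine le_trans (sInf_le ⟨Function.update a i (a i ⊓ b), fun j => ?_, fun j => ?_, rfl⟩) ?_
        · rcases eq_or_ne j i with rfl | hj
          · simp only [Function.comp_apply, Function.update_self, stoneEmb_inf]
            exact le_inf (ha _).1 (hX.trans_le (sInf_le ⟨b, hb, rfl⟩))
          · simpa only [Function.comp_apply, Function.update_of_ne hj] using (ha j).1
        · rcases eq_or_ne j i with rfl | hj
          · simp only [Function.comp_apply, Function.update_self, stoneEmb_inf]
            exact inf_le_left.trans (ha _).2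
          · simpa only [Function.comp_apply, Function.update_of_ne hj] using (ha j).2
        · refine (stoneEmb B).monotone (le_trans ?_ (inf_le_right : a i ⊓ b ≤ b))
          conv_rhs => rw [← Function.update_self i (a i ⊓ b) a]
          fin_cases i
          · exact inf_le_left
          · exact inf_le_right
      exact le_inf ((key 0).trans (hpx 0)) ((key 1).trans (hpx 1))
    · rintro ω ⟨h0, h1⟩
      rw [opExt, sigmaExt, Set.sSup_eq_sUnion, Set.mem_sUnion]
      refine ⟨_, ⟨fun _ => {ω}, ⊤, fun _ => singleton_mem_closedElements ω,
        fun _ => top_mem_openElements, ?_, le_top, rfl⟩, ?_⟩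
      · intro i
        rw [Set.singleton_subset_iff]
        fin_cases i
        exacts [h0, h1]
      · rintro _ ⟨a, ha, -, rfl⟩
        rw [stoneEmb_inf]
        exact ⟨ha 0 rfl, ha 1 rfl⟩
  | pi =>
    refine le_antisymm ?_ (le_sInf ?_)
    · have key : ∀ i, piExt (stoneEmb B) (fun a : Fin 2 → B => a 0 ⊓ a 1) x ≤ x i := by
        intro i ω hω
        by_contra hωx
        rw [piExt, Set.sInf_eq_sInter, Set.mem_sInter] at hω
        -- If `ω ∉ x i`, this interval contains no tuple whose `i`-th entry contains `ω`.
        have := hω _ ⟨⊥, Function.update ⊤ i {ω}ᶜ, fun _ => bot_mem_closedElements, fun j => ?_,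
          bot_le, fun j => ?_, rfl⟩
        · obtain ⟨_, ⟨a, -, ha, rfl⟩, hωa⟩ := this
          have hi := ha i
          rw [Function.update_self] at hi
          refine hi ?_ rfl
          rw [stoneEmb_inf] at hωa
          fin_cases i
          exacts [hωa.1, hωa.2]
        · rcases eq_or_ne j i with rfl | hj
          · rw [Function.update_self]
            exact compl_singleton_mem_openElements ω
          · rw [Function.update_of_ne hj]
            exact top_mem_openElements
        · rcases eq_or_ne j i with rfl | hj
          · rw [Function.update_self]
            exact Set.subset_compl_singleton_iff.2 hωx
          · rw [Function.update_of_ne hj]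
            exact le_top
      exact le_inf (key 0) (key 1)
    · rintro _ ⟨p, q, hp, hq, hpx, hxq, rfl⟩ ω ⟨h0, h1⟩
      have hω : ∀ i, ω ∈ x i := by
        intro i
        fin_cases i
        exacts [h0, h1]
      -- An interpolant need not contain `ω`, so a basic set `b` below `q i` with `ω ∈ b` is joined
      -- to it.
      have : ∀ i, ∃ a, p i ≤ stoneEmb B a ∧ stoneEmb B a ≤ q i ∧ ω ∈ stoneEmb B a := by
        intro i
        obtain ⟨a, ha, ha'⟩ := exists_stoneEmb_between (hp i) (hq i) (hpx.trans hxq i)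
        have hωq : ω ∈ q i := hxq i (hω i)
        obtain ⟨Y, hY⟩ := hq i
        rw [hY] at hωq
        obtain ⟨_, ⟨b, hb, rfl⟩, hωb⟩ := hωq
        refine ⟨a ⊔ b, ?_⟩
        rw [stoneEmb_sup]
        exact ⟨ha.trans le_sup_left, sup_le ha' (hY ▸ le_sSup ⟨b, hb, rfl⟩), Or.inr hωb⟩
      choose a ha using this
      refine ⟨_, ⟨a, fun i => (ha i).1, fun i => (ha i).2.1, rfl⟩, ?_⟩
      rw [stoneEmb_inf]
      exact ⟨(ha 0).2.2, (ha 1).2.2⟩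

end Extensions

/-! ### Terms for the Boolean operations and the operators. -/

section Terms

variable {O : ℕ → Type u} {α : Type*}

/-- The meet of two terms. -/
def infTerm (s t : (baoLanguage O).Term α) : (baoLanguage O).Term α :=
  Term.func (l := 2) (L := baoLanguage O) BAOFunctions.inf ![s, t]

/-- The join of two terms. -/
def supTerm (s t : (baoLanguage O).Term α) : (baoLanguage O).Term α :=
  Term.func (l := 2) (L := baoLanguage O) BAOFunctions.sup ![s, t]

/-- The complement of a term. -/
def complTerm (s : (baoLanguage O).Term α) : (baoLanguage O).Term α :=
  Term.func (l := 1) (L := baoLanguage O) BAOFunctions.compl ![s]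

/-- The constant `0` as a term. -/
def botTerm : (baoLanguage O).Term α :=
  Term.func (l := 0) (L := baoLanguage O) BAOFunctions.bot ![]

/-- The constant `1` as a term. -/
def topTerm : (baoLanguage O).Term α :=
  Term.func (l := 0) (L := baoLanguage O) BAOFunctions.top ![]

/-- The term `f(0, …, 0, s, 0, …, 0)` with `s` at coordinate `i`. -/
def operAtTerm {n : ℕ} (f : O n) (i : Fin n) (s : (baoLanguage O).Term α) :
    (baoLanguage O).Term α :=
  Term.func (L := baoLanguage O) (BAOFunctions.op f) (Function.update (fun _ => botTerm) i s)

/-- No Boolean structure is assumed, so this applies directly to the canonical extension. -/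
theorem realize_operAtTerm_eq_oper {A : Type w} [(baoLanguage O).Structure A] {n : ℕ} (f : O n)
    (i : Fin n) (s : (baoLanguage O).Term α) (v : α → A) :
    (operAtTerm f i s).realize v =
      oper f (Function.update (fun _ => (botTerm : (baoLanguage O).Term α).realize v) i
        (s.realize v)) := by
  refine congrArg (oper f) (funext fun j => ?_)
  rcases eq_or_ne j i with rfl | hj
  · simp
  · simp [Function.update_of_ne hj]

variable {A : Type w} [BooleanAlgebra A] [(baoLanguage O).Structure A]

theorem IsBAO.realize_infTerm (hA : IsBAO O A) (s t : (baoLanguage O).Term α) (v : α → A) :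
    (infTerm s t).realize v = s.realize v ⊓ t.realize v :=
  hA.map_inf _

theorem IsBAO.realize_supTerm (hA : IsBAO O A) (s t : (baoLanguage O).Term α) (v : α → A) :
    (supTerm s t).realize v = s.realize v ⊔ t.realize v :=
  hA.map_sup _

theorem IsBAO.realize_complTerm (hA : IsBAO O A) (s : (baoLanguage O).Term α) (v : α → A) :
    (complTerm s).realize v = (s.realize v)ᶜ :=
  hA.map_compl _

theorem IsBAO.realize_botTerm (hA : IsBAO O A) (v : α → A) :
    (botTerm : (baoLanguage O).Term α).realize v = ⊥ :=
  hA.map_bot _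

theorem IsBAO.realize_topTerm (hA : IsBAO O A) (v : α → A) :
    (topTerm : (baoLanguage O).Term α).realize v = ⊤ :=
  hA.map_top _

theorem IsBAO.realize_operAtTerm (hA : IsBAO O A) {n : ℕ} (f : O n) (i : Fin n)
    (s : (baoLanguage O).Term α) (v : α → A) :
    (operAtTerm f i s).realize v = oper f (Function.update (fun _ => ⊥) i (s.realize v)) := by
  rw [realize_operAtTerm_eq_oper, hA.realize_botTerm]

variable (O) in
theorem exists_finset_inf_term {ι : Type*} (s : Finset ι) (t : ι → (baoLanguage O).Term α) :
    ∃ T : (baoLanguage O).Term α, ∀ (A : Type w) [BooleanAlgebra A] [(baoLanguage O).Structure A],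
      IsBAO O A → ∀ v : α → A, T.realize v = s.inf fun i => (t i).realize v := by
  classical
  induction s using Finset.induction_on with
  | empty => exact ⟨topTerm, fun A _ _ hA v => hA.realize_topTerm v⟩
  | insert i s _ ih =>
    obtain ⟨T, hT⟩ := ih
    refine ⟨infTerm (t i) T, fun A _ _ hA v => ?_⟩
    rw [hA.realize_infTerm, hT A hA, Finset.inf_insert]

end Terms

/-! ### Monotonicity, `□`-fixed elements and iterates of `□`. -/

section Operators

variable {O : ℕ → Type u} {A : Type w} [BooleanAlgebra A] [(baoLanguage O).Structure A]

theorem IsBAO.oper_update_inf (hA : IsBAO O A) {n : ℕ} (f : O n) (x : Fin n → A) (i : Fin n)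
    (a b : A) : oper f (Function.update x i (a ⊓ b)) =
      oper f (Function.update x i a) ⊓ oper f (Function.update x i b) := by
  classical
  simpa using hA.oper_meet n f x i {a, b}

theorem IsBAO.oper_update_top (hA : IsBAO O A) {n : ℕ} (f : O n) (x : Fin n → A) (i : Fin n) :
    oper f (Function.update x i ⊤) = ⊤ := by
  simpa using hA.oper_meet n f x i ∅

/-- Meet preservation gives monotonicity in one coordinate; the coordinates are changed one at a
time. -/
theorem IsBAO.oper_mono (hA : IsBAO O A) {n : ℕ} (f : O n) : Monotone (oper (A := A) f) := by
  classical
  intro x y hxy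
  have key : ∀ s : Finset (Fin n), oper f x ≤ oper f (s.piecewise y x) := by
    intro s
    induction s using Finset.induction_on with
    | empty => simp
    | insert i s hi ih =>
      refine ih.trans ?_
      have h := hA.oper_update_inf f (s.piecewise y x) i (x i) (y i)
      rw [inf_eq_left.2 (hxy i), ← Finset.piecewise_insert] at h
      rw [Finset.piecewise_insert] at h ⊢
      have h' : Function.update (s.piecewise y x) i (x i) = s.piecewise y x := by
        rw [Function.update_eq_self_iff, Finset.piecewise_eq_of_notMem _ _ _ hi]
      rw [h'] at h
      exact inf_eq_left.1 h.symm
  simpa using key Finset.univ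

/-- The elements `a` with `a ≤ f(0, …, 0, a, 0, …, 0)` for all operators `f` and coordinates, that
is, with `□ a = a`. -/
def BoxClosed (O : ℕ → Type u) {A : Type w} [BooleanAlgebra A] [(baoLanguage O).Structure A]
    (a : A) : Prop :=
  ∀ (n : ℕ) (f : O n) (i : Fin n), a ≤ oper f (Function.update (fun _ => ⊥) i a)

/-- In each coordinate `a ≤ f(0, …, a, …, 0) ≤ f(…, a, …)`, and the meet with `f(…, x i, …)` merges
into `f(…, a ∧ x i, …)`. -/
theorem IsBAO.inf_oper_le (hA : IsBAO O A) {a : A} (ha : BoxClosed O a) {n : ℕ} (f : O n)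
    (x : Fin n → A) : a ⊓ oper f x ≤ oper f fun i => a ⊓ x i := by
  classical
  have key : ∀ s : Finset (Fin n), a ⊓ oper f x ≤ oper f (s.piecewise (fun i => a ⊓ x i) x) := by
    intro s
    induction s using Finset.induction_on with
    | empty => simp
    | insert i s hi ih =>
      have h' : Function.update (s.piecewise (fun i => a ⊓ x i) x) i (x i) =
          s.piecewise (fun i => a ⊓ x i) x := by
        rw [Function.update_eq_self_iff, Finset.piecewise_eq_of_notMem _ _ _ hi]
      rw [Finset.piecewise_insert, hA.oper_update_inf, h']
      refine le_inf (inf_le_left.trans ((ha n f i).trans (hA.oper_mono f ?_))) ih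
      exact update_le_update_iff.2 ⟨le_rfl, fun _ _ => bot_le⟩
  simpa using key Finset.univ

/-- Relativization to a `□`-fixed element is a congruence; this is the source of all quotients used
later. -/
theorem IsBAO.inf_funMap_congr (hA : IsBAO O A) {a : A} (ha : BoxClosed O a) {n : ℕ}
    (f : (baoLanguage O).Functions n) {x y : Fin n → A} (h : ∀ i, a ⊓ x i = a ⊓ y i) :
    a ⊓ Structure.funMap f x = a ⊓ Structure.funMap f y := by
  cases f with
  | inf => rw [hA.map_inf, hA.map_inf, inf_inf_distrib_left, h, h, ← inf_inf_distrib_left]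
  | sup => rw [hA.map_sup, hA.map_sup, inf_sup_left, h, h, ← inf_sup_left]
  | compl =>
    rw [hA.map_compl, hA.map_compl, ← sdiff_eq, ← sdiff_eq, ← sdiff_inf_self_left,
      ← sdiff_inf_self_left a (y 0), h]
  | bot => rw [hA.map_bot, hA.map_bot]
  | top => rw [hA.map_top, hA.map_top]
  | op f =>
    have key : ∀ x y : Fin n → A, (∀ i, a ⊓ x i = a ⊓ y i) → a ⊓ oper f x ≤ a ⊓ oper f y := by
      intro x y h
      refine le_inf inf_le_left ((hA.inf_oper_le ha f x).trans (hA.oper_mono f fun i => ?_))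
      exact (h i).trans_le inf_le_right
    exact le_antisymm (key x y h) (key y x fun i => (h i).symm)

theorem IsBAO.inf_realize_congr (hA : IsBAO O A) {a : A} (ha : BoxClosed O a) {α : Type*}
    {x y : α → A} (h : ∀ i, a ⊓ x i = a ⊓ y i) (t : (baoLanguage O).Term α) :
    a ⊓ t.realize x = a ⊓ t.realize y := by
  induction t with
  | var i => exact h i
  | func f ts ih => exact hA.inf_funMap_congr ha f ih

theorem BoxClosed.inf (hA : IsBAO O A) {a b : A} (ha : BoxClosed O a) (hb : BoxClosed O b) :
    BoxClosed O (a ⊓ b) := by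
  intro n f i
  rw [hA.oper_update_inf]
  exact inf_le_inf (ha n f i) (hb n f i)

theorem boxClosed_top (hA : IsBAO O A) : BoxClosed O (⊤ : A) := fun _ f i =>
  (hA.oper_update_top f _ i).ge

theorem BoxClosed.finset_inf (hA : IsBAO O A) {ι : Type*} (s : Finset ι) {a : ι → A}
    (ha : ∀ i ∈ s, BoxClosed O (a i)) : BoxClosed O (s.inf a) :=
  Finset.inf_induction (boxClosed_top hA) (fun _ h _ h' => h.inf hA h') ha

variable [Fintype (Σ n, O n)]

theorem le_box_iff {a c : A} : c ≤ box (O := O) a ↔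
    c ≤ a ∧ ∀ (n : ℕ) (f : O n) (i : Fin n), c ≤ oper f (Function.update (fun _ => ⊥) i a) := by
  simp only [box, boxAt, le_inf_iff, Finset.le_inf_iff, Finset.mem_univ, true_implies, Sigma.forall]
  exact ⟨fun h => ⟨h.1, fun n f i => (h.2 n f i).1⟩, fun h => ⟨h.1, fun n f i => ⟨h.2 n f i, h.1⟩⟩⟩

theorem box_le (a : A) : box (O := O) a ≤ a := (le_box_iff.1 le_rfl).1

theorem boxClosed_iff_le_box {a : A} : BoxClosed O a ↔ a ≤ box (O := O) a := by
  simp [BoxClosed, le_box_iff]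

theorem IsBAO.box_mono (hA : IsBAO O A) : Monotone (box (O := O) (A := A)) := by
  intro a b hab
  refine le_box_iff.2 ⟨(box_le a).trans hab, fun n f i => ((le_box_iff.1 le_rfl).2 n f i).trans
    (hA.oper_mono f ?_)⟩
  exact update_le_update_iff.2 ⟨hab, fun _ _ => le_rfl⟩

theorem BoxClosed.le_box_iterate (hA : IsBAO O A) {a c : A} (hc : BoxClosed O c) (h : c ≤ a)
    (k : ℕ) : c ≤ (box (O := O))^[k] a := by
  induction k with
  | zero => exact h
  | succ k ih =>
    rw [Function.iterate_succ_apply']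
    exact (boxClosed_iff_le_box.1 hc).trans (hA.box_mono ih)

theorem antitone_box_iterate (a : A) : Antitone fun k => (box (O := O))^[k] a := by
  refine antitone_nat_of_succ_le fun k => ?_
  rw [Function.iterate_succ_apply']
  exact box_le _

theorem box_iterate_le (a : A) (k : ℕ) : (box (O := O))^[k] a ≤ a :=
  antitone_box_iterate a (Nat.zero_le k)

variable (O) in
-- One term serves all algebras at once, so inequalities about `□ᵏ` become identities between terms,
-- which pass along presentations and ultraproducts.
theorem exists_box_iterate_term {α : Type*} (s : (baoLanguage O).Term α) (k : ℕ) :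
    ∃ T : (baoLanguage O).Term α, ∀ (A : Type w) [BooleanAlgebra A] [(baoLanguage O).Structure A],
      IsBAO O A → ∀ v : α → A, T.realize v = (box (O := O))^[k] (s.realize v) := by
  induction k with
  | zero => exact ⟨s, fun A _ _ _ v => rfl⟩
  | succ k ih =>
    obtain ⟨T, hT⟩ := ih
    choose T' hT' using fun f : Σ n, O n => exists_finset_inf_term.{u, w} O Finset.univ
      fun i : Fin f.1 => infTerm (operAtTerm f.2 i T) T
    obtain ⟨T'', hT''⟩ := exists_finset_inf_term.{u, w} O Finset.univ T'
    refine ⟨infTerm T T'', fun A _ _ hA v => ?_⟩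
    rw [Function.iterate_succ_apply', ← hT A hA, hA.realize_infTerm, hT'' A hA]
    simp only [hT' _ A hA, hA.realize_infTerm, hA.realize_operAtTerm]
    rfl

end Operators

/-! ### Stabilization of the powers of `□`. -/

section Stabilization

variable {O : ℕ → Type u}

/-- The powerset of the Stone space of a Boolean algebra with operators, with the `σ`- and
`π`-extensions of the operations as prescribed by `ε`. -/
@[reducible]
def extStructure (ε : ∀ n : ℕ, (baoLanguage O).Functions n → ExtKind) (B : Type u)
    [BooleanAlgebra B] [(baoLanguage O).Structure B] :
    (baoLanguage O).Structure (Set (StoneSpace B)) where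
  funMap f x := opExt (ε _ f) (stoneEmb B) (fun a => Structure.funMap f a) x
  RelMap _ _ := False

theorem realize_infTerm_extStructure (ε : ∀ n : ℕ, (baoLanguage O).Functions n → ExtKind)
    (B : Type u) [BooleanAlgebra B] [(baoLanguage O).Structure B] (hB : IsBAO O B) {α : Type*}
    (s t : (baoLanguage O).Term α) (v : α → Set (StoneSpace B)) :
    letI := extStructure ε B
    (infTerm s t).realize v = s.realize v ⊓ t.realize v := by
  let _ := extStructure ε B
  change opExt _ _ (fun a : Fin 2 → B => Structure.funMap (L := baoLanguage O) BAOFunctions.inf a) _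
    = _
  simp only [hB.map_inf]
  exact opExt_inf _ _

theorem realize_botTerm_extStructure (ε : ∀ n : ℕ, (baoLanguage O).Functions n → ExtKind)
    (B : Type u) [BooleanAlgebra B] [(baoLanguage O).Structure B] (hB : IsBAO O B) {α : Type*}
    (v : α → Set (StoneSpace B)) :
    letI := extStructure ε B
    (botTerm : (baoLanguage O).Term α).realize v = ⊥ := by
  refine Eq.trans ?_ ((opExt_emb (ε 0 BAOFunctions.bot) (stoneEmb B)
    (fun a => Structure.funMap (L := baoLanguage O) BAOFunctions.bot a) Fin.elim0).trans ?_)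
  · exact congrArg (opExt _ _ _) (Subsingleton.elim _ _)
  · rw [hB.map_bot, stoneEmb_bot]

/-- In a coherent variety of BAOs that is closed under canonical extensions, `□ᴺ = □ᴺ⁺¹` for
some `N`. -/
theorem exists_box_iterate_le_succ [Fintype (Σ n, O n)]
    {E : Set ((baoLanguage O).Term ℕ × (baoLanguage O).Term ℕ)}
    {ε : ∀ n : ℕ, (baoLanguage O).Functions n → ExtKind}
    (hBAO : IsVarietyOfBAOs (O := O) E) (hcan : ClosedUnderCanonicalExtensions (O := O) ε E)
    (hcoh : Coherent E) :
    ∃ N : ℕ, ∀ (A : Type u) [BooleanAlgebra A] [(baoLanguage O).Structure A], IsBAO O A →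
      Satisfies E A → ∀ a : A, (box (O := O))^[N] a ≤ (box (O := O))^[N + 1] a := by
  by_contra! hcon
  choose A instA strA hA hAE x hx using hcon
  let z : ∀ N, A N := fun N => (box (O := O))^[N] (x N)
  choose T hT using exists_box_iterate_term.{u, u} O
    (Term.var 0 : (baoLanguage O).Term (Fin 2))
  -- the algebra presented by `z ≤ y ≤ x` and `y ≤ □ y`
  let X : (baoLanguage O).Term (Fin 3) := Term.var 0
  let Y : (baoLanguage O).Term (Fin 3) := Term.var 1
  let Z : (baoLanguage O).Term (Fin 3) := Term.var 2
  let R : Set ((baoLanguage O).Term (Fin 3) × (baoLanguage O).Term (Fin 3)) :=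
    {(infTerm Z Y, Z), (infTerm Y X, Y)} ∪
      Set.range fun f : Σ f : (Σ n, O n), Fin f.1 => (infTerm Y (operAtTerm f.1.2 f.2 Y), Y)
  obtain ⟨F, _, a, hF, hFR, hFuniv⟩ := exists_finitelyPresented E R
    ((Set.toFinite _).union (Set.finite_range _))
  have hlez : ∀ k, (infTerm (Term.var 1) (T k)).realize ![a 0, a 2] =
      (Term.var 1 : (baoLanguage O).Term (Fin 2)).realize ![a 0, a 2] := by
    obtain ⟨_, hFB⟩ := hBAO F hF.1
    intro k
    have h1 := hFR _ (Or.inl (Or.inl rfl))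
    have h2 := hFR _ (Or.inl (Or.inr rfl))
    have h3 : BoxClosed O (a 1) := by
      intro n f i
      have := hFR _ (Or.inr ⟨⟨⟨n, f⟩, i⟩, rfl⟩)
      rw [hFB.realize_infTerm, hFB.realize_operAtTerm] at this
      exact inf_eq_left.1 this
    rw [hFB.realize_infTerm] at h1 h2
    rw [hFB.realize_infTerm, hT k F hFB]
    exact inf_eq_left.2 ((inf_eq_left.1 h1).trans (h3.le_box_iterate hFB (inf_eq_left.1 h2) k))
  -- The witness `y` is dropped: coherence finitely axiomatizes what its existence says about `x`
  -- and `z`.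
  obtain ⟨Q, hQfin, hQ, hQuniv⟩ := hcoh.exists_finite_relations hF ![a 0, a 2]
  suffices h : ∃ N, ∀ r ∈ Q, r.1.realize ![x N, z N] = r.2.realize ![x N, z N] by
    obtain ⟨N, hN⟩ := h
    -- With `z = □ᴺ x`, the consequence `z ≤ □ᴺ⁺¹ x` is exactly what fails in `A N`.
    have := hQuniv (A N) (hAE N) _ hN _ _ (hlez (N + 1))
    rw [(hA N).realize_infTerm, hT (N + 1) (A N) (hA N)] at this
    exact hx N (inf_eq_left.1 this)
  -- an ultraproduct in which `z ≤ □ᵏ x` for all `k`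
  let U : Ultrafilter ℕ := Filter.hyperfilter ℕ
  let B : Type u := (U : Filter ℕ).Product A
  have hBE : Satisfies E B := Satisfies.ultraproduct U hAE
  obtain ⟨_, hB⟩ := hBAO B hBE
  let b : Fin 2 → ∀ N, A N := ![x, z]
  let b' : Fin 2 → B := fun i => (b i : (U : Filter ℕ).Product A)
  have hb : ∀ N, (fun i => b i N) = ![x N, z N] := fun N => by
    funext i
    fin_cases i <;> rfl
  have los : ∀ s t : (baoLanguage O).Term (Fin 2), s.realize b' = t.realize b' ↔
      ∀ᶠ N in (U : Filter ℕ), s.realize ![x N, z N] = t.realize ![x N, z N] := fun s t => by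
    have h := ultraproduct_realize_eq_iff U b s t
    simp only [hb] at h
    exact h
  have hbk : ∀ k, b' 1 ≤ (box (O := O))^[k] (b' 0) := fun k => by
    have h : (infTerm (Term.var 1) (T k)).realize b' =
        (Term.var 1 : (baoLanguage O).Term (Fin 2)).realize b' := by
      refine (los _ _).2 (Filter.Eventually.filter_mono Nat.hyperfilter_le_atTop ?_)
      filter_upwards [Filter.eventually_ge_atTop k] with N hN
      rw [(hA N).realize_infTerm, hT k (A N) (hA N)]
      exact inf_eq_left.2 (antitone_box_iterate (x N) hN)
    rw [hB.realize_infTerm, hT k B hB] at h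
    exact inf_eq_left.1 h
  suffices h : ∀ r ∈ Q, r.1.realize b' = r.2.realize b' by
    have : ∀ᶠ N in (U : Filter ℕ), ∀ r ∈ Q, r.1.realize ![x N, z N] = r.2.realize ![x N, z N] :=
      (Filter.eventually_all_finite hQfin).2 fun r hr => (los _ _).1 (h r hr)
    exact this.exists
  -- its canonical extension
  let _ := extStructure ε B
  have hCE : Satisfies E (Set (StoneSpace B)) := hcan B hB hBE (Set (StoneSpace B)) (stoneEmb B)
    ⟨isCanonicalExtension_stoneEmb, fun n f x => rfl⟩
  let e : B →[baoLanguage O] Set (StoneSpace B) :=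
    ⟨stoneEmb B, fun f x => (opExt_emb _ (stoneEmb B) _ x).symm, fun r => Empty.elim r⟩
  -- The image of the generator `y`: the meet of all `□ᵏ x`, which exists in the extension and turns
  -- out to be `□`-fixed.
  let m : Set (StoneSpace B) := sInf (stoneEmb B '' Set.range fun k => (box (O := O))^[k] (b' 0))
  have hm : ∀ k, m ≤ stoneEmb B ((box (O := O))^[k] (b' 0)) := fun k => sInf_le ⟨_, ⟨k, rfl⟩, rfl⟩
  have hmc : m ∈ closedElements (stoneEmb B) := ⟨_, rfl⟩
  -- By compactness finitely many `□ᵏ x` suffice, and since they form a chain, one does.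
  have hmbox : ∀ c : B, m ≤ stoneEmb B c → ∃ k, (box (O := O))^[k] (b' 0) ≤ c := by
    intro c hc
    obtain ⟨S₀, hS₀, T₀, hT₀, hfin, -, hle⟩ := (isCanonicalExtension_stoneEmb.compact
      (stoneEmb B '' Set.range fun k => (box (O := O))^[k] (b' 0))
      (by rintro _ ⟨c, -, rfl⟩; exact emb_mem_closedElements _ _) {stoneEmb B c}
      (by rintro _ rfl; exact emb_mem_openElements _ _)).1 (by rwa [sSup_singleton])
    have hle' : sInf S₀ ≤ stoneEmb B c := by
      refine hle.trans ((sSup_le_sSup hT₀).trans ?_)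
      rw [sSup_singleton]
    have hlow : ∃ k, ∀ s ∈ S₀, stoneEmb B ((box (O := O))^[k] (b' 0)) ≤ s := by
      have : ∀ s ∈ S₀, ∀ᶠ k in Filter.atTop, stoneEmb B ((box (O := O))^[k] (b' 0)) ≤ s := by
        intro s hs
        obtain ⟨_, ⟨k, rfl⟩, rfl⟩ := hS₀ hs
        filter_upwards [Filter.eventually_ge_atTop k] with j hj
        exact (stoneEmb B).monotone (antitone_box_iterate _ hj)
      exact ((Filter.eventually_all_finite hfin).2 this).exists
    obtain ⟨k, hk⟩ := hlow
    exact ⟨k, (stoneEmb B).le_iff_le.1 ((le_sInf hk).trans hle')⟩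
  have hinf := @realize_infTerm_extStructure O ε B _ _ hB (Fin 3)
  obtain ⟨φ, hφ⟩ := hFuniv (Set (StoneSpace B)) hCE ![stoneEmb B (b' 0), m, stoneEmb B (b' 1)] (by
    rintro r ((rfl | rfl) | ⟨⟨⟨n, f⟩, i⟩, rfl⟩)
    · rw [hinf]
      refine inf_eq_left.2 (le_sInf ?_)
      rintro _ ⟨_, ⟨k, rfl⟩, rfl⟩
      exact (stoneEmb B).monotone (hbk k)
    · rw [hinf]
      exact inf_eq_left.2 (hm 0)
    · rw [hinf, realize_operAtTerm_eq_oper]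
      have hbot : (botTerm : (baoLanguage O).Term (Fin 3)).realize
          ![stoneEmb B (b' 0), m, stoneEmb B (b' 1)] = ⊥ :=
        realize_botTerm_extStructure ε B hB _
      rw [hbot]
      -- All coordinates are closed, so it suffices to bound `f c` for tuples `c` of the algebra
      -- above them. If `□ᵏ x ≤ c i`, then `m ≤ □ᵏ⁺¹ x ≤ f(0, …, □ᵏ x, …, 0) ≤ f(c)`.
      refine inf_eq_left.2 (le_opExt_of_closed _ _ (fun j => ?_) fun c hc => ?_)
      · by_cases hj : j = i
        · rw [hj, Function.update_self]
          exact hmc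
        · rw [Function.update_of_ne hj]
          exact bot_mem_closedElements
      · have hci := hc i
        rw [Function.update_self] at hci
        obtain ⟨k, hk⟩ := hmbox (c i) hci
        refine (hm (k + 1)).trans ((stoneEmb B).monotone ?_)
        rw [Function.iterate_succ_apply']
        refine ((le_box_iff.1 le_rfl).2 n f i).trans (hB.oper_mono f ?_)
        exact update_le_iff.2 ⟨hk, fun _ _ => bot_le⟩)
  have hc : φ ∘ ![a 0, a 2] = e ∘ b' := by
    funext i
    fin_cases i
    exacts [hφ 0, hφ 2]
  intro r hr
  -- Relations of `F` pass along `φ` to the extension and are reflected to `B` by the embedding.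
  apply (stoneEmb B).injective
  change e _ = e _
  rw [← HomClass.realize_term, ← HomClass.realize_term, ← hc, HomClass.realize_term,
    HomClass.realize_term, hQ r hr]

end Stabilization

/-! ### Quotients with only trivial `□`-fixed elements, and the discriminator. -/

section Discriminator

variable {O : ℕ → Type u}

/-- The quotient of an algebra by the filter generated by the `□`-fixed elements of an
ultrafilter. -/
theorem exists_quotient_of_ultrafilter {A : Type w} [BooleanAlgebra A]
    [(baoLanguage O).Structure A] (hA : IsBAO O A) (ω : StoneSpace A) :
    ∃ (Q : Type w) (_ : (baoLanguage O).Structure Q) (φ : A →[baoLanguage O] Q),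
      Function.Surjective φ ∧
        ∀ x y, φ x = φ y ↔ ∃ a, BoxClosed O a ∧ ω.1 a = true ∧ a ⊓ x = a ⊓ y := by
  let θ : Setoid A :=
    { r := fun x y => ∃ a, BoxClosed O a ∧ ω.1 a = true ∧ a ⊓ x = a ⊓ y
      iseqv := by
        refine ⟨fun x => ⟨⊤, boxClosed_top hA, ω.2.1, rfl⟩, ?_, ?_⟩
        · rintro x y ⟨a, ha, hωa, h⟩
          exact ⟨a, ha, hωa, h.symm⟩
        · rintro x y z ⟨a, ha, hωa, h⟩ ⟨b, hb, hωb, h'⟩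
          refine ⟨a ⊓ b, ha.inf hA hb, by rw [ω.2.2.1, hωa, hωb]; rfl, ?_⟩
          rw [inf_right_comm, h, inf_right_comm, inf_assoc, h', inf_assoc] }
  let _ : (baoLanguage O).Prestructure θ :=
    { toStructure := inferInstance
      fun_equiv := fun {n f} x y hxy => by
        choose a ha hωa h using hxy
        -- The finitely many coordinates have different witnesses; their meet is `□`-fixed, lies in
        -- the ultrafilter and works for all of them.
        refine ⟨Finset.univ.inf a, BoxClosed.finset_inf hA _ fun i _ => ha i, ?_,
          hA.inf_funMap_congr (BoxClosed.finset_inf hA _ fun i _ => ha i) f fun i => ?_⟩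
        · rw [← mem_stoneEmb, stoneEmb_finset_inf, Finset.inf_eq_iInf]
          exact Set.mem_iInter₂.2 fun i _ => hωa i
        · have hle : Finset.univ.inf a ≤ a i := Finset.inf_le (Finset.mem_univ i)
          rw [← inf_eq_left.2 hle, inf_assoc, h, inf_assoc]
      rel_equiv := fun {n r} _ _ _ => Empty.elim r }
  let φ : A →[baoLanguage O] Quotient θ :=
    ⟨fun a => ⟦a⟧, fun f x => (funMap_quotient_mk' θ f x).symm, fun r => Empty.elim r⟩
  exact ⟨Quotient θ, inferInstance, φ, Quotient.mk_surjective, fun x y => Quotient.eq⟩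

variable [Fintype (Σ n, O n)]

/-- Modulo `a`, the elements `¬a` and `0` agree, so `a ∧ g(¬a) = a ∧ g(0) = 0`. Conjugacy turns this
into `◇a ∧ ¬a = 0`, that is, `¬a ≤ □¬a`. -/
theorem BoxClosed.compl_of_conjugate {A : Type w} [BooleanAlgebra A] [(baoLanguage O).Structure A]
    (hA : IsBAO O A) {g : (baoLanguage O).Term (Fin 1)}
    (hg : ∀ x y : A, (box (O := O) xᶜ)ᶜ ⊓ y = ⊥ ↔ x ⊓ g.realize ![y] = ⊥) {a : A}
    (ha : BoxClosed O a) : BoxClosed O aᶜ := by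
  have hbot : g.realize ![(⊥ : A)] = ⊥ := by
    rw [← top_inf_eq (g.realize ![(⊥ : A)]), ← hg, inf_bot_eq]
  have h : a ⊓ g.realize ![aᶜ] = ⊥ := by
    rw [hA.inf_realize_congr ha (y := ![⊥]) (by simp), hbot, inf_bot_eq]
  rw [← hg, ← disjoint_iff, disjoint_compl_left_iff] at h
  exact boxClosed_iff_le_box.2 h

theorem boxClosed_box_iterate {A : Type w} [BooleanAlgebra A] [(baoLanguage O).Structure A] {N : ℕ}
    {a : A} (h : (box (O := O))^[N] a ≤ (box (O := O))^[N + 1] a) :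
    BoxClosed O ((box (O := O))^[N] a) := by
  rw [Function.iterate_succ_apply'] at h
  exact boxClosed_iff_le_box.2 h

variable (O) in
/-- If only `0` and `1` are fixed by `□`, and `□ᴺ = □ᴺ⁺¹`, the discriminator is a term. -/
theorem exists_discriminator_term (N : ℕ) : ∃ t : (baoLanguage O).Term (Fin 3),
    ∀ (A : Type w) [BooleanAlgebra A] [(baoLanguage O).Structure A], IsBAO O A →
      (∀ a : A, (box (O := O))^[N] a ≤ (box (O := O))^[N + 1] a) →
      (∀ a : A, BoxClosed O a → a = ⊥ ∨ a = ⊤) → IsDiscriminatorTerm t A := by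
  let X : (baoLanguage O).Term (Fin 3) := Term.var 0
  let Y : (baoLanguage O).Term (Fin 3) := Term.var 1
  let Z : (baoLanguage O).Term (Fin 3) := Term.var 2
  obtain ⟨D, hD⟩ := exists_box_iterate_term.{u, w} O
    (supTerm (infTerm X Y) (infTerm (complTerm X) (complTerm Y))) N
  refine ⟨supTerm (infTerm D Z) (infTerm (complTerm D) X), fun A _ _ hA hN hsimple x y z => ?_⟩
  have hDr : D.realize ![x, y, z] = (box (O := O))^[N] (bihimp x y) := by
    simp only [hD A hA, hA.realize_supTerm, hA.realize_infTerm, hA.realize_complTerm, bihimp_eq']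
    rfl
  have ht : (supTerm (infTerm D Z) (infTerm (complTerm D) X)).realize ![x, y, z] =
      (D.realize ![x, y, z] ⊓ z) ⊔ ((D.realize ![x, y, z])ᶜ ⊓ x) := by
    simp only [hA.realize_supTerm, hA.realize_infTerm, hA.realize_complTerm]
    rfl
  rw [ht, hDr]
  constructor
  · rintro rfl
    rw [bihimp_self, top_le_iff.1 ((boxClosed_top hA).le_box_iterate hA le_rfl N)]
    simp
  · intro hxy
    have : (box (O := O))^[N] (bihimp x y) = ⊥ := by
      refine (hsimple _ (boxClosed_box_iterate (hN _))).resolve_right fun h => hxy ?_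
      exact bihimp_eq_top.1 (top_le_iff.1 (h.ge.trans (box_iterate_le _ N)))
    rw [this]
    simp

/-- If complements of `□`-fixed elements are `□`-fixed and `□ᴺ = □ᴺ⁺¹`, distinct elements are
separated by a homomorphism to a member of the variety in which only `0` and `1` are `□`-fixed. -/
theorem exists_hom_simple {E : Set ((baoLanguage O).Term ℕ × (baoLanguage O).Term ℕ)}
    (hBAO : IsVarietyOfBAOs (O := O) E) {N : ℕ} {A : Type u} [BooleanAlgebra A]
    [(baoLanguage O).Structure A] (hA : IsBAO O A) (hAE : Satisfies E A)
    (hN : ∀ a : A, (box (O := O))^[N] a ≤ (box (O := O))^[N + 1] a)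
    (hcompl : ∀ a : A, BoxClosed O a → BoxClosed O aᶜ) {s t : A} (hst : s ≠ t) :
    ∃ (Q : Type u) (_ : BooleanAlgebra Q) (_ : (baoLanguage O).Structure Q)
      (φ : A →[baoLanguage O] Q), IsBAO O Q ∧ Satisfies E Q ∧ (∀ a : Q, BoxClosed O a → a = ⊥ ∨ a = ⊤) ∧ φ s ≠ φ t := by
  let d : A := (box (O := O))^[N] (bihimp s t)
  have hd : d ≠ ⊤ := fun h => hst (bihimp_eq_top.1 (top_le_iff.1 (h.ge.trans (box_iterate_le _ N))))
  -- Any `□`-fixed element identifying `s` and `t` lies below `d`; an ultrafilter omitting `d`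
  -- therefore keeps them apart.
  obtain ⟨ω, hω⟩ := exists_stoneSpace_apply_eq_true (a := dᶜ) (by rwa [Ne, compl_eq_bot])
  obtain ⟨Q, _, φ, hφ, hker⟩ := exists_quotient_of_ultrafilter hA ω
  have hQE : Satisfies E (Q) := by
    intro p hp x
    choose y hy using fun i => hφ (x i)
    obtain rfl : φ ∘ y = x := funext hy
    rw [HomClass.realize_term, HomClass.realize_term, hAE p hp]
  obtain ⟨_, hQ⟩ := hBAO (Q) hQE
  obtain ⟨T, hT⟩ := exists_box_iterate_term.{u, u} O
    (Term.var 0 : (baoLanguage O).Term (Fin 1)) N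
  have hφbot : φ ⊥ = ⊥ := by
    rw [← hA.realize_botTerm (α := Fin 0) Fin.elim0, ← HomClass.realize_term, hQ.realize_botTerm]
  have hφtop : φ ⊤ = ⊤ := by
    rw [← hA.realize_topTerm (α := Fin 0) Fin.elim0, ← HomClass.realize_term, hQ.realize_topTerm]
  refine ⟨Q, _, _, φ, hQ, hQE, fun q hq => ?_, fun h => ?_⟩
  · obtain ⟨b, rfl⟩ := hφ q
    -- A `□`-fixed element of the quotient lifts to the `□`-fixed element `□ᴺ b`. Either that or its
    -- complement, which is also `□`-fixed, lies in the ultrafilter.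
    have hφb : φ b = φ ((box (O := O))^[N] b) := by
      have h := HomClass.realize_term (g := φ) (t := T) (v := ![b])
      rw [hT _ hQ, hT _ hA] at h
      exact (le_antisymm (hq.le_box_iterate hQ le_rfl N) (box_iterate_le _ N)).trans h
    have hc := boxClosed_box_iterate (hN b)
    rw [hφb]
    cases hωc : ω.1 ((box (O := O))^[N] b) with
    | true =>
      right
      rw [← hφtop]
      exact (hker _ _).2 ⟨_, hc, hωc, by simp⟩
    | false =>
      left
      rw [← hφbot]
      exact (hker _ _).2 ⟨_, hcompl _ hc, by rw [ω.2.2.2, hωc]; rfl, by simp⟩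
  · obtain ⟨a, ha, hωa, h⟩ := (hker _ _).1 h
    have had : a ≤ d := ha.le_box_iterate hA
      (le_bihimp_iff.2 ⟨by
        rw [inf_comm]
        exact h.ge.trans inf_le_right, by
        rw [inf_comm]
        exact h.trans_le inf_le_right⟩) N
    have hωd : ω.1 d = true := (stoneEmb A).monotone had hωa
    rw [ω.2.2.2, hωd] at hω
    simp at hω

end Discriminator

end BAOVariety

theorem corollary5p3 (O : ℕ → Type u) [Fintype (Σ n, O n)]
    (E : Set ((BAOVariety.baoLanguage O).Term ℕ × (BAOVariety.baoLanguage O).Term ℕ))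
    (ε : ∀ n : ℕ, (BAOVariety.baoLanguage O).Functions n → BAOVariety.ExtKind)
    (hBAO : BAOVariety.IsVarietyOfBAOs (O := O) E)
    (hcyclic : BAOVariety.IsCyclic (O := O) E)
    (hcanonical : BAOVariety.ClosedUnderCanonicalExtensions (O := O) ε E)
    (hcoherent : BAOVariety.Coherent E) :
    BAOVariety.IsDiscriminatorVariety E := by
  obtain ⟨N, hN⟩ := BAOVariety.exists_box_iterate_le_succ hBAO hcanonical hcoherent
  obtain ⟨g, hg⟩ := hcyclic
  obtain ⟨t, ht⟩ := BAOVariety.exists_discriminator_term.{u, u} O N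
  -- The generating class consists of the members whose only `□`-fixed elements are `0` and `1`. An
  -- identity failing in some member fails in one of its quotients in this class.
  refine ⟨fun A _ => BAOVariety.Satisfies E A ∧ ∃ _ : BooleanAlgebra A, BAOVariety.IsBAO O A ∧
    ∀ a : A, BAOVariety.BoxClosed O a → a = ⊥ ∨ a = ⊤, t, ?_, fun A _ h => h.1, ?_⟩
  · rintro A _ ⟨hAE, _, hA, hsimple⟩
    exact ht A hA (hN A hA hAE) hsimple
  · intro E' hE' A _ hAE p hp x
    obtain ⟨_, hA⟩ := hBAO A hAE
    by_contra hne
    obtain ⟨Q, _, _, φ, hQ, hQE, hsimple, hφ⟩ := BAOVariety.exists_hom_simple hBAO hA hAE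
      (hN A hA hAE) (fun a ha => ha.compl_of_conjugate hA (hg A hA hAE)) hne
    apply hφ
    rw [← FirstOrder.Language.HomClass.realize_term, ← FirstOrder.Language.HomClass.realize_term]
    exact hE' Q ⟨hQE, _, hQ, hsimple⟩ p hp _
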